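/- Let $\mathcal R(s)$ denote Riemann's auxiliary function, the entire function defined for every $s\in\mathbb C$ by \[ \mathcal R(s)=\int_{0\swarrow1}\frac{x^{-s}e^{\pi i x^2}}{e^{\pi i x}-e^{-\pi i x}}\,dx , \] where the path of integration is the straight line of direction $e^{\pi i/4}$ through the point $1/2$, traversed from the upper right to the lower left, and $x^{-s}=e^{-s\log x}$ with the principal branch of the logarithm. For every real number $\sigma_1>3$ there is a constant $C$, depending only on $\sigma_1$, such that for all real $\sigma\ge\sigma_1$ and all real $t_0,T$ with $1\le t_0<T$, the function $t\mapsto\log|\mathcal R(\sigma+it)|$ is integrable on $[t_0,T]$ and \[ \Bigl|\int_{t_0}^T\log|\mathcal R(\sigma+it)|\,dt\Bigr|\le C\,2^{-\sigma}. \] -/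

import Mathlib

open Complex MeasureTheory

noncomputable section

/-- The direction `e^{π i / 4}`. -/
def auxDir : ℂ := Complex.exp ((Real.pi : ℂ) * I / 4)

/-- The straight line through `1/2` with direction `e^{π i / 4}`. It meets the real axis only at
`1/2` (so it avoids the integers) and it does not meet the cut `(-∞, 0]` of the principal
logarithm. -/
def auxLine (u : ℝ) : ℂ := 1 / 2 + (u : ℂ) * auxDir

/-- The integrand `x^{-s} e^{π i x²} / (e^{π i x} - e^{-π i x})`, with the principal branch of the
power. -/
def auxIntegrand (s x : ℂ) : ℂ :=
  x ^ (-s) * Complex.exp ((Real.pi : ℂ) * I * x ^ 2) /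
    (Complex.exp ((Real.pi : ℂ) * I * x) - Complex.exp (-((Real.pi : ℂ) * I * x)))

/-- Riemann's auxiliary function
`R(s) = ∫_{0 ↙ 1} x^{-s} e^{π i x²} / (e^{π i x} - e^{-π i x}) dx`,
the integral along the line of slope one that crosses the real axis between `0` and `1`, traversed
from the upper right to the lower left. The parametrization `auxLine` runs from the lower left to
the upper right, hence the minus sign; `dx = auxDir du`. -/
def riemannAux (s : ℂ) : ℂ :=
  -∫ u : ℝ, auxIntegrand s (auxLine u) * auxDir

end

/-! Moving the line of integration to the right across the integers `1, …, m` collects the residues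
`k ^ (-s)`: `R(s)` is `∑_{k ≤ m} k ^ (-s)` minus the integral along the parallel line through `a = m
+ 1/2` (`riemannAux_eq_sum_sub`). If `a` lies slightly to the right of the saddle point `√(t/2π)`,
the new integral is at most a constant times `(a/√2) ^ (-σ)`, where `a/√2` is the distance from the
origin to the line (`mul_arg_slant_sub_le`, `norm_slantIntegral_le`). Hence `R(s) = 1 + O(2 ^ (-σ))`
for `σ ≥ 3`, `t ≥ 0`, and `|R - 1| ≤ 1/2` as soon as `t` or `σ` is large.

In a quadrant where `|R - 1| ≤ 1/2`, `log R` is holomorphic and `O(2 ^ (-σ))`. Cauchy's theorem on a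
rectangle reaching to `Re s = +∞` trades the vertical integral for two horizontal ones, whose size
does not depend on `T` (`abs_integral_log_norm_le`).

What remains is a compact rectangle that may contain zeros of `R`. There `log |R|` has only
logarithmic singularities, dominated by an integrable function of `t` alone, so the integral is
bounded uniformly in `σ` (`exists_abs_integral_log_norm_riemannAux_le`). Since `σ` is bounded there,
this is also `O(2 ^ (-σ))`. -/

noncomputable section

open Filter Topology Set

/-! ### Residue of a simple pole between two parallel lines. -/

/-- If `g` is holomorphic on a neighbourhood of the strip `|Im z| ≤ c` and `g z / z` decays at
infinity in the strip, then the integrals of `g z / z` over the two boundary lines differ by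
`2 π i g 0`. -/
theorem integral_line_sub_integral_line_of_simple_pole {g : ℂ → ℂ} {c : ℝ} (hc : 0 < c) {U : Set ℂ}
    (hUo : IsOpen U) (hU : ∀ z : ℂ, |z.im| ≤ c → z ∈ U) (hg : DifferentiableOn ℂ g U)
    (h₁ : Integrable fun v : ℝ => g (v + (-c : ℝ) * I) / (v + (-c : ℝ) * I))
    (h₂ : Integrable fun v : ℝ => g (v + c * I) / (v + c * I)) {K : ℝ}
    (hK : ∀ z : ℂ, |z.im| ≤ c → 1 ≤ |z.re| → ‖g z / z‖ ≤ K / |z.re|) :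
    (∫ v : ℝ, g (v + (-c : ℝ) * I) / (v + (-c : ℝ) * I)) - ∫ v : ℝ, g (v + c * I) / (v + c * I) =
      2 * Real.pi * I * g 0 := by
  -- `H z = (g z - g 0) / z` has no pole, so Cauchy's theorem applies to it. The removed term `g 0 /
  -- z` is integrated by hand: its two lines differ by the kernel `2ic / (v² + c²)`.
  set H : ℂ → ℂ := dslope g 0 with hH
  have h0U : (0 : ℂ) ∈ U := hU 0 (by simpa using hc.le)
  have hHd : DifferentiableOn ℂ H U :=
    (Complex.differentiableOn_dslope (hUo.mem_nhds h0U)).2 hg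
  have hHval : ∀ z : ℂ, z ≠ 0 → H z = g z / z - g 0 / z := by
    intro z hz
    rw [hH, dslope_of_ne _ hz, slope_def_field]
    simp only [sub_zero]
    ring
  have hne : ∀ v w : ℝ, w ≠ 0 → (v : ℂ) + w * I ≠ 0 := by
    intro v w hw h
    have := congrArg Complex.im h
    simp at this
    exact hw this
  -- the difference of the integrands
  have hdiff : ∀ v : ℝ, H (v + (-c : ℝ) * I) - H (v + c * I) =
      g (v + (-c : ℝ) * I) / (v + (-c : ℝ) * I) - g (v + c * I) / (v + c * I) -
        g 0 * (2 * I * (c / (v ^ 2 + c ^ 2) : ℝ)) := by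
    intro v
    rw [hHval _ (hne v (-c) (neg_ne_zero.2 hc.ne')), hHval _ (hne v c hc.ne')]
    have e1 := hne v (-c) (neg_ne_zero.2 hc.ne')
    have e2 := hne v c hc.ne'
    have e3 : ((v : ℂ) ^ 2 + c ^ 2) ≠ 0 := by
      have : (v ^ 2 + c ^ 2 : ℝ) ≠ 0 := by positivity
      exact_mod_cast this
    have e4 : (v : ℂ) ^ 2 + c ^ 2 = (v + (-c : ℝ) * I) * (v + c * I) := by
      push_cast
      linear_combination (c : ℂ) ^ 2 * I_sq
    have key : g 0 / (v + (-c : ℝ) * I) - g 0 / (v + c * I) =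
        g 0 * (2 * I * (c / (v ^ 2 + c ^ 2) : ℝ)) := by
      rw [show ((c / (v ^ 2 + c ^ 2) : ℝ) : ℂ) = c / ((v + (-c : ℝ) * I) * (v + c * I)) by
        rw [← e4]; push_cast; rfl]
      rw [div_sub_div _ _ e1 e2, mul_div_assoc', mul_div_assoc']
      congr 1
      push_cast
      ring
    linear_combination -key
  have hcauchy : ∀ c' : ℝ, IntegrableOn (fun v : ℝ => c' / (v ^ 2 + c ^ 2)) univ := by
    intro c'
    have := (integrable_inv_one_add_sq.comp_div hc.ne').const_mul (c' / c ^ 2)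
    rw [integrableOn_univ]
    refine this.congr (ae_of_all _ fun v => ?_)
    field_simp
    ring
  have hpi : ∫ v : ℝ, c / (v ^ 2 + c ^ 2) = Real.pi := by
    have e : ∀ v : ℝ, c / (v ^ 2 + c ^ 2) = c⁻¹ * (1 + (v / c) ^ 2)⁻¹ := by
      intro v
      field_simp
      ring
    simp_rw [e]
    rw [integral_const_mul, Measure.integral_comp_div (fun v : ℝ => (1 + v ^ 2)⁻¹) c,
      integral_univ_inv_one_add_sq, smul_eq_mul, abs_of_pos hc]
    field_simp
  have hpole : Integrable fun v : ℝ => g 0 * (2 * I * (c / (v ^ 2 + c ^ 2) : ℝ)) :=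
    (((integrableOn_univ.1 (hcauchy c)).ofReal).const_mul (2 * I)).const_mul (g 0)
  -- Only the difference is integrable in general: on a single line `g 0 / z` decays like `1 / v`.
  have hint : Integrable fun v : ℝ => H (v + (-c : ℝ) * I) - H (v + c * I) := by
    simp_rw [hdiff]
    exact (h₁.sub h₂).sub hpole
  have hlim := intervalIntegral_tendsto_integral hint tendsto_neg_atTop_atBot tendsto_id
  -- the vertical sides
  have hside : ∀ z : ℂ, |z.im| ≤ c → 1 ≤ |z.re| → ‖H z‖ ≤ (K + ‖g 0‖) / |z.re| := by
    intro z hz hz'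
    have hz0 : z ≠ 0 := by
      rintro rfl
      norm_num at hz'
    rw [hHval z hz0, add_div]
    refine (norm_sub_le _ _).trans (add_le_add (hK z hz hz') ?_)
    rw [norm_div]
    have : |z.re| ≤ ‖z‖ := abs_re_le_norm z
    gcongr
  have hrect : ∀ R : ℝ, 1 ≤ R →
      ‖∫ v in (-R)..R, (H (v + (-c : ℝ) * I) - H (v + c * I))‖ ≤ (4 * c * (K + ‖g 0‖)) / R := by
    intro R hR
    have hcont : ∀ w : ℝ, |w| ≤ c → Continuous fun v : ℝ => H (v + w * I) := by
      intro w hw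
      refine hHd.continuousOn.comp_continuous (by fun_prop) fun v => hU _ ?_
      simpa using hw
    have hR0 : (0 : ℝ) < R := by linarith
    have hrc := Complex.integral_boundary_rect_eq_zero_of_differentiableOn H
      (⟨-R, -c⟩ : ℂ) (⟨R, c⟩ : ℂ) (hHd.mono ?_)
    · simp only at hrc
      rw [intervalIntegral.integral_sub ((hcont (-c) (by rw [abs_neg, abs_of_pos hc])).intervalIntegrable _ _)
        ((hcont c (by rw [abs_of_pos hc])).intervalIntegrable _ _)]
      have hs : ∀ R' : ℝ, |R'| = R →
          ‖I • ∫ y in (-c)..c, H (R' + y * I)‖ ≤ 2 * c * (K + ‖g 0‖) / R := by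
        intro R' hR'
        rw [norm_smul, norm_I, one_mul]
        refine (intervalIntegral.norm_integral_le_of_norm_le_const (C := (K + ‖g 0‖) / R) ?_).trans ?_
        · intro y hy
          rw [uIoc_of_le (by linarith)] at hy
          have := hside (R' + y * I) (by simpa [abs_le] using ⟨hy.1.le, hy.2⟩)
            (by simpa [hR'] using hR)
          simpa [hR'] using this
        · rw [sub_neg_eq_add, abs_of_pos (by linarith)]
          apply le_of_eq
          ring
      have a1 := hs R (abs_of_pos hR0)
      have a2 := hs (-R) (by rw [abs_neg, abs_of_pos hR0])
      have : (∫ v in (-R)..R, H (v + (-c : ℝ) * I)) - ∫ v in (-R)..R, H (v + c * I) =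
          (I • ∫ y in (-c)..c, H ((-R : ℝ) + y * I)) - I • ∫ y in (-c)..c, H (R + y * I) := by
        linear_combination hrc
      rw [this]
      refine (norm_sub_le _ _).trans ((add_le_add a2 a1).trans (le_of_eq ?_))
      ring
    · intro z hz
      apply hU
      rw [mem_reProdIm, uIcc_of_le (by simp; linarith), uIcc_of_le (by simp; linarith)] at hz
      exact abs_le.2 hz.2
  have hzero : Tendsto (fun R : ℝ => ∫ v in (-R)..R, (H (v + (-c : ℝ) * I) - H (v + c * I)))
      atTop (𝓝 0) := by
    refine squeeze_zero_norm' ((eventually_ge_atTop 1).mono hrect) ?_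
    exact tendsto_const_nhds.div_atTop tendsto_id
  have h0 := tendsto_nhds_unique hlim hzero
  simp_rw [hdiff] at h0
  have e := integral_sub (h₁.sub h₂) hpole
  simp only [Pi.sub_apply] at e
  rw [e, integral_sub h₁ h₂, integral_const_mul, integral_const_mul,
    integral_complex_ofReal, hpi] at h0
  linear_combination h0

/-! ### The integrand on lines of slope one. -/

/-- The point with parameter `v` on the line through `a` with direction `1 + i`. -/
def slant (a v : ℝ) : ℂ := a + (1 + I) * v

@[simp] theorem slant_re (a v : ℝ) : (slant a v).re = a + v := by simp [slant]

@[simp] theorem slant_im (a v : ℝ) : (slant a v).im = v := by simp [slant]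

theorem continuous_slant (a : ℝ) : Continuous (slant a) := by
  unfold slant
  fun_prop

theorem slant_mem_slitPlane {a : ℝ} (ha : 0 < a) (v : ℝ) : slant a v ∈ slitPlane := by
  rw [mem_slitPlane_iff, slant_re, slant_im]
  by_cases h : v = 0
  · left
    simpa [h] using ha
  · exact Or.inr h

theorem normSq_slant (a v : ℝ) : ‖slant a v‖ ^ 2 = (a + v) ^ 2 + v ^ 2 := by
  rw [Complex.sq_norm, normSq_apply, slant_re, slant_im]
  ring

theorem le_norm_slant (a v : ℝ) : a / √2 ≤ ‖slant a v‖ := by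
  refine le_of_sq_le_sq ?_ (norm_nonneg _)
  rw [normSq_slant, div_pow, Real.sq_sqrt (by norm_num)]
  nlinarith [sq_nonneg (a + 2 * v)]

theorem norm_cexp_pi_mul_sq (x : ℂ) :
    ‖cexp ((Real.pi : ℂ) * I * x ^ 2)‖ = Real.exp (-(2 * Real.pi * (x.re * x.im))) := by
  rw [norm_exp]
  congr 1
  simp [pow_two]
  ring

theorem Real.one_add_sq_div_two_le_cosh (y : ℝ) : 1 + y ^ 2 / 2 ≤ Real.cosh y := by
  have h : (y / 2) ^ 2 ≤ Real.sinh (y / 2) ^ 2 := by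
    rw [sq_le_sq, Real.abs_sinh]
    exact Real.self_le_sinh_iff.2 (abs_nonneg _)
  have e : Real.cosh y = Real.cosh (y / 2) ^ 2 + Real.sinh (y / 2) ^ 2 := by
    rw [← Real.cosh_two_mul]
    ring_nf
  rw [e, Real.cosh_sq]
  linarith

/-- On a line through a half-integer the denominator is, up to a unimodular factor, `2 cosh(-y +
iy)` with `y = πv`, and `|cosh(-y + iy)|² = cosh² y - sin² y`. Quadratic growth, uniform in `m`, is
all that integrability needs. -/
theorem one_add_sq_le_norm_denominator (m : ℕ) (v : ℝ) :
    1 + v ^ 2 ≤ ‖cexp ((Real.pi : ℂ) * I * slant (m + 1 / 2) v) -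
      cexp (-((Real.pi : ℂ) * I * slant (m + 1 / 2) v))‖ := by
  set y : ℝ := Real.pi * v with hy
  have hx : (Real.pi : ℂ) * I * slant (m + 1 / 2) v =
      m * (Real.pi * I) + Real.pi / 2 * I + (-y + y * I) := by
    simp only [slant, hy]
    push_cast
    linear_combination (Real.pi * v : ℂ) * I_sq
  have hm : cexp (m * (Real.pi * I)) = (-1) ^ m := by
    rw [Complex.exp_nat_mul, exp_pi_mul_I]
  have hm' : cexp (-(m * (Real.pi * I))) = (-1) ^ m := by
    rw [Complex.exp_neg, hm, ← inv_pow]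
    norm_num
  have e : cexp ((Real.pi : ℂ) * I * slant (m + 1 / 2) v) -
      cexp (-((Real.pi : ℂ) * I * slant (m + 1 / 2) v)) =
      (-1) ^ m * I * (2 * Complex.cosh (-y + y * I)) := by
    rw [hx, neg_add, neg_add (_ * _), Complex.exp_add, Complex.exp_add (_ * _), Complex.exp_add (_ + _),
      Complex.exp_add (-(_ * _)), hm, hm', Complex.exp_neg (Real.pi / 2 * I), Complex.exp_pi_div_two_mul_I,
      Complex.two_cosh, inv_I]
    ring
  have hc : ‖Complex.cosh (-y + y * I)‖ ^ 2 = Real.cosh y ^ 2 - Real.sin y ^ 2 := by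
    rw [Complex.sq_norm, Complex.cosh_add, Complex.cosh_mul_I, Complex.sinh_mul_I,
      Complex.cosh_neg, Complex.sinh_neg, ← ofReal_cosh, ← ofReal_sinh, ← ofReal_cos,
      ← ofReal_sin, normSq_apply]
    simp only [add_re, mul_re, ofReal_re, ofReal_im, I_re, I_im, add_im, mul_im, neg_re, neg_im]
    have h1 := Real.cosh_sq y
    have h2 := Real.sin_sq_add_cos_sq y
    linear_combination (-Real.sin y ^ 2) * h1 + (Real.cosh y ^ 2) * h2
  rw [e, norm_mul, norm_mul, norm_mul, norm_I, norm_pow, norm_neg, norm_one, one_pow, one_mul,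
    one_mul, Complex.norm_two]
  refine le_of_sq_le_sq ?_ (by positivity)
  rw [mul_pow, hc]
  have h1 : 1 + y ^ 2 / 2 ≤ Real.cosh y := Real.one_add_sq_div_two_le_cosh y
  have h2 : Real.sin y ^ 2 ≤ y ^ 2 := Real.sin_sq_le_sq
  have h3 : Real.sin y ^ 2 ≤ 1 := Real.sin_sq_le_one y
  have h4 : (1 + y ^ 2 / 2) ^ 2 ≤ Real.cosh y ^ 2 := by gcongr
  have h5 : v ^ 2 * 9 ≤ y ^ 2 := by
    rw [hy, mul_pow]
    have : 9 ≤ Real.pi ^ 2 := by nlinarith [Real.pi_gt_three]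
    nlinarith [sq_nonneg v]
  have h6 : (1 + v ^ 2) ^ 2 ≤ (1 + y ^ 2 / 2) ^ 2 := by
    gcongr
    nlinarith [sq_nonneg v]
  nlinarith [sq_nonneg v, sq_nonneg y]

theorem hasDerivAt_arg_slant {a : ℝ} (ha : 0 < a) (v : ℝ) :
    HasDerivAt (fun v => arg (slant a v)) (a / ((a + v) ^ 2 + v ^ 2)) v := by
  have h1 : HasDerivAt (slant a) (1 + I) v := by
    have := (((hasDerivAt_id v).ofReal_comp).const_mul (1 + I)).const_add (a : ℂ)
    exact this.congr_deriv (by simp)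
  have h2 := imCLM.hasFDerivAt.comp_hasDerivAt v (h1.clog_real (slant_mem_slitPlane ha v))
  have e : (fun v => arg (slant a v)) = imCLM ∘ fun v => log (slant a v) := by
    ext v
    simp [log_im]
  rw [e]
  refine h2.congr_deriv ?_
  rw [imCLM_apply, div_im, ← Complex.sq_norm, normSq_slant]
  simp
  ring

/-- The size of `x ^ (-i t) e ^ (π i x ^ 2)` on the slanted line through `a`, when `a` is slightly
larger than the saddle point `√(t / 2π)`. -/
theorem mul_arg_slant_sub_le {a t : ℝ} (ha : 7 / 2 ≤ a) (ht : 0 ≤ t)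
    (h₁ : t ≤ 2 * Real.pi * a ^ 2) (h₂ : 2 * Real.pi * (a ^ 2 - 7 * a) ≤ t) (v : ℝ) :
    t * arg (slant a v) - 2 * Real.pi * ((a + v) * v) ≤ 66 * Real.pi := by
  have hpi := Real.pi_pos
  have ha0 : 0 < a := by linarith
  have hq : ∀ v : ℝ, 0 < (a + v) ^ 2 + v ^ 2 := fun v => by nlinarith [sq_nonneg (a + 2 * v)]
  set φ : ℝ → ℝ := fun v => t * arg (slant a v) - 2 * Real.pi * ((a + v) * v) with hφ
  have hφ' : ∀ v, HasDerivAt φ (t * (a / ((a + v) ^ 2 + v ^ 2)) - 2 * Real.pi * (a + 2 * v)) v := by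
    intro v
    have h := (((hasDerivAt_id v).const_add a).mul (hasDerivAt_id v)).const_mul (2 * Real.pi)
    refine (((hasDerivAt_arg_slant ha0 v).const_mul t).sub h).congr_deriv ?_
    simp
    ring
  have hφ0 : φ 0 = 0 := by
    simp [hφ, slant, arg_ofReal_of_nonneg ha0.le]
  have hcont : ∀ S, ContinuousOn φ S := fun S v _ => (hφ' v).continuousAt.continuousWithinAt
  change φ v ≤ _
  rcases le_total 0 v with hv | hv
  · have hanti : AntitoneOn φ (Ici 0) := by
      refine antitoneOn_of_hasDerivWithinAt_nonpos (convex_Ici 0) (hcont _)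
        (fun x _ => (hφ' x).hasDerivWithinAt) fun x hx => ?_
      rw [interior_Ici] at hx
      have hx0 : 0 < x := hx
      rw [sub_nonpos, mul_div_assoc', div_le_iff₀ (hq x)]
      calc t * a ≤ 2 * Real.pi * a ^ 2 * a := by gcongr
        _ = 2 * Real.pi * a * a ^ 2 := by ring
        _ ≤ 2 * Real.pi * (a + 2 * x) * ((a + x) ^ 2 + x ^ 2) := by
          gcongr <;> nlinarith
    have := hanti (self_mem_Ici) hv hv
    rw [hφ0] at this
    linarith
  -- Adding `2π(14v + 3v²/2)` makes the phase increasing, so `φ w ≤ -2π(14w + 3w²/2)`. The maximum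
  -- of the right side, at `w = -14/3`, is `196π/3 < 66π`.
  have key : ∀ w : ℝ, -(a / 2) ≤ w → w ≤ 0 → φ w ≤ 66 * Real.pi := by
    set ψ : ℝ → ℝ := fun v => φ v + 2 * Real.pi * (14 * v + 3 / 2 * v ^ 2) with hψ
    have hψ' : ∀ v, HasDerivAt ψ (t * (a / ((a + v) ^ 2 + v ^ 2)) - 2 * Real.pi * (a + 2 * v) +
        2 * Real.pi * (14 + 3 * v)) v := by
      intro v
      have h := (((hasDerivAt_id v).const_mul 14).add
        (((hasDerivAt_id v).pow 2).const_mul (3 / 2))).const_mul (2 * Real.pi)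
      refine ((hφ' v).add h).congr_deriv ?_
      simp
      ring
    have hmono : MonotoneOn ψ (Icc (-(a / 2)) 0) := by
      refine monotoneOn_of_hasDerivWithinAt_nonneg (convex_Icc _ _)
        (fun v _ => (hψ' v).continuousAt.continuousWithinAt)
        (fun x _ => (hψ' x).hasDerivWithinAt) fun x hx => ?_
      rw [interior_Icc] at hx
      obtain ⟨hx1, hx2⟩ := hx
      -- For `-a/2 < x < 0`, `(a + x)² + x² ≤ a(a + x)`, and `14(a + x) ≥ 7a` pays for the slack
      -- `7a` in `h₂`.
      have main : 2 * Real.pi * (a - x - 14) ≤ t * (a / ((a + x) ^ 2 + x ^ 2)) := by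
        rw [mul_div_assoc', le_div_iff₀ (hq x)]
        rcases le_total (a - x - 14) 0 with h | h
        · have : 0 ≤ t * a := by positivity
          nlinarith [mul_nonneg (mul_nonneg hpi.le (neg_nonneg.2 h)) (hq x).le]
        · calc 2 * Real.pi * (a - x - 14) * ((a + x) ^ 2 + x ^ 2)
              ≤ 2 * Real.pi * (a - x - 14) * (a * (a + x)) := by
                gcongr
                nlinarith
            _ = 2 * Real.pi * (a ^ 2 - x ^ 2 - 14 * (a + x)) * a := by ring
            _ ≤ 2 * Real.pi * (a ^ 2 - 7 * a) * a := by
                have : a ^ 2 - x ^ 2 - 14 * (a + x) ≤ a ^ 2 - 7 * a := by nlinarith [sq_nonneg x]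
                gcongr ?_ * a
                exact mul_le_mul_of_nonneg_left this (by positivity)
            _ ≤ t * a := by gcongr
      linarith
    intro w hw hw0
    have := hmono ⟨hw, hw0⟩ ⟨by linarith, le_rfl⟩ hw0
    simp only [hψ, hφ0] at this
    nlinarith [mul_nonneg hpi.le (sq_nonneg (3 * w + 14))]
  rcases le_total (-(a / 2)) v with hv' | hv'
  · exact key v hv' hv
  · have hmono : MonotoneOn φ (Iic (-(a / 2))) := by
      refine monotoneOn_of_hasDerivWithinAt_nonneg (convex_Iic _) (hcont _)
        (fun x _ => (hφ' x).hasDerivWithinAt) fun x hx => ?_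
      rw [interior_Iic] at hx
      have hx0 : x < -(a / 2) := hx
      have := hq x
      have h3 : 0 ≤ t * (a / ((a + x) ^ 2 + x ^ 2)) := by positivity
      nlinarith [mul_nonneg hpi.le (by linarith : 0 ≤ -(a + 2 * x))]
    exact (hmono hv' self_mem_Iic hv').trans (key _ le_rfl (by linarith))

theorem norm_cpow_neg_slant {a : ℝ} (ha : 0 < a) (s : ℂ) (v : ℝ) :
    ‖slant a v ^ (-s)‖ = ‖slant a v‖ ^ (-s.re) * Real.exp (s.im * arg (slant a v)) := by
  rw [norm_cpow_of_ne_zero (slitPlane_ne_zero (slant_mem_slitPlane ha v)), neg_re, neg_im,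
    mul_neg, Real.exp_neg, div_inv_eq_mul, mul_comm (arg _)]

theorem norm_auxIntegrand_le (m : ℕ) {s : ℂ} (hs : 0 ≤ s.re) {M : ℝ} (v : ℝ)
    (hM : s.im * arg (slant (m + 1 / 2) v) - 2 * Real.pi * ((m + 1 / 2 + v) * v) ≤ M) :
    ‖auxIntegrand s (slant (m + 1 / 2) v)‖ ≤
      ((m + 1 / 2 : ℝ) / √2) ^ (-s.re) * Real.exp M * (1 + v ^ 2)⁻¹ := by
  have ha : (0 : ℝ) < m + 1 / 2 := by positivity
  rw [auxIntegrand, norm_div, norm_mul, norm_cpow_neg_slant ha, norm_cexp_pi_mul_sq, slant_re,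
    slant_im, div_eq_mul_inv, mul_assoc (_ ^ _), ← Real.exp_add]
  gcongr ?_ * Real.exp ?_ * ?_⁻¹
  · exact Real.rpow_le_rpow_of_nonpos (by positivity) (le_norm_slant _ _) (by linarith)
  · linarith
  · exact one_add_sq_le_norm_denominator m v

theorem continuous_auxIntegrand_slant (m : ℕ) (s : ℂ) :
    Continuous fun v => auxIntegrand s (slant (m + 1 / 2) v) := by
  have ha : (0 : ℝ) < m + 1 / 2 := by positivity
  have hc := continuous_slant (m + 1 / 2)
  unfold auxIntegrand
  refine Continuous.div ((hc.cpow continuous_const fun v => slant_mem_slitPlane ha v).mul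
    (by fun_prop)) (by fun_prop) fun v => ?_
  rw [← norm_pos_iff]
  exact lt_of_lt_of_le (by positivity) (one_add_sq_le_norm_denominator m v)

/-- Completing the square in `v`. This crude bound ignores the saddle point; it serves
integrability, the contour shift and differentiation in `s`, where uniformity in `t` does not
matter. -/
theorem mul_arg_slant_sub_le_of_abs (a t v : ℝ) :
    t * arg (slant a v) - 2 * Real.pi * ((a + v) * v) ≤
      Real.pi * |t| + Real.pi * a ^ 2 / 2 := by
  have h1 : t * arg (slant a v) ≤ |t| * Real.pi := by
    refine (le_abs_self _).trans ?_
    rw [abs_mul]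
    gcongr
    exact abs_arg_le_pi _
  nlinarith [mul_nonneg Real.pi_pos.le (sq_nonneg (a + 2 * v))]

theorem integrable_auxIntegrand_slant (m : ℕ) {s : ℂ} (hs : 0 ≤ s.re) :
    Integrable fun v => auxIntegrand s (slant (m + 1 / 2) v) :=
  (integrable_inv_one_add_sq.const_mul _).mono'
    (continuous_auxIntegrand_slant m s).aestronglyMeasurable
    (ae_of_all _ fun v => norm_auxIntegrand_le m hs v (mul_arg_slant_sub_le_of_abs _ _ v))

/-! ### Integrals along the slanted lines. -/

/-- The integral of the integrand of Riemann's auxiliary function along the slanted line through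
`m + 1 / 2`, traversed upwards. -/
def slantIntegral (m : ℕ) (s : ℂ) : ℂ :=
  ∫ v : ℝ, auxIntegrand s (slant (m + 1 / 2) v) * (1 + I)

theorem riemannAux_eq_neg_slantIntegral (s : ℂ) : riemannAux s = -slantIntegral 0 s := by
  have hsq : (0 : ℝ) < √2 := by positivity
  have hd : auxDir * √2 = 1 + I := by
    have h2 : ((√2 : ℝ) : ℂ) * ((√2 : ℝ) : ℂ) = 2 := by
      rw [← ofReal_mul, Real.mul_self_sqrt (by norm_num)]
      norm_num
    rw [auxDir, show (Real.pi : ℂ) * I / 4 = ((Real.pi / 4 : ℝ) : ℂ) * I by push_cast; ring,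
      exp_mul_I, ← ofReal_cos, ← ofReal_sin, Real.cos_pi_div_four, Real.sin_pi_div_four]
    push_cast
    linear_combination (1 + I) / 2 * h2
  have h := Measure.integral_comp_mul_right (fun u : ℝ => auxIntegrand s (auxLine u) * auxDir) (√2)
  rw [abs_of_pos (inv_pos.2 hsq)] at h
  have e : ∀ v : ℝ, auxLine (v * √2) = slant ((0 : ℕ) + 1 / 2) v := by
    intro v
    rw [auxLine, slant, ← hd]
    push_cast
    ring
  rw [riemannAux, slantIntegral, ← hd]
  simp_rw [← e]
  congr 1
  have h3 : ∫ v : ℝ, auxIntegrand s (auxLine (v * √2)) * (auxDir * √2) =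
      (√2 : ℂ) * ∫ v : ℝ, auxIntegrand s (auxLine (v * √2)) * auxDir := by
    rw [← integral_const_mul]
    congr 1
    ext v
    ring
  rw [h3, h, real_smul, ofReal_inv, mul_inv_cancel_left₀ (ofReal_ne_zero.2 hsq.ne')]

theorem norm_slantIntegral_le (m : ℕ) {s : ℂ} (hs : 0 ≤ s.re) {M : ℝ}
    (hM : ∀ v : ℝ,
      s.im * arg (slant (m + 1 / 2) v) - 2 * Real.pi * ((m + 1 / 2 + v) * v) ≤ M) :
    ‖slantIntegral m s‖ ≤ 2 * Real.pi * Real.exp M * ((m + 1 / 2 : ℝ) / √2) ^ (-s.re) := by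
  have h1 : ‖(1 + I : ℂ)‖ ≤ 2 := (norm_add_le _ _).trans (by simp; norm_num)
  refine (norm_integral_le_of_norm_le
    (g := fun v => 2 * (((m + 1 / 2 : ℝ) / √2) ^ (-s.re) * Real.exp M) * (1 + v ^ 2)⁻¹)
    (integrable_inv_one_add_sq.const_mul _) (ae_of_all _ fun v => ?_)).trans ?_
  · rw [norm_mul]
    refine (mul_le_mul (norm_auxIntegrand_le m hs v (hM v)) h1 (norm_nonneg _)
      (by positivity)).trans (le_of_eq (by ring))
  · rw [integral_const_mul, integral_univ_inv_one_add_sq]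
    apply le_of_eq
    ring

/-! ### Mean values of `log ‖f‖` for `f` close to `1`. -/

theorem integral_two_rpow_neg_le (a b : ℝ) :
    ∫ x in a..b, (2 : ℝ) ^ (-x) ≤ 2 ^ (-a) / Real.log 2 := by
  have hlog : 0 < Real.log 2 := Real.log_pos (by norm_num)
  have hd : ∀ x : ℝ, HasDerivAt (fun x : ℝ => -((2 : ℝ) ^ (-x) / Real.log 2)) ((2 : ℝ) ^ (-x)) x := by
    intro x
    have := (((hasDerivAt_neg x).const_rpow (a := 2) (by norm_num)).div_const (Real.log 2)).neg
    refine HasDerivAt.congr_deriv this ?_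
    field_simp
  have hc : Continuous fun x : ℝ => (2 : ℝ) ^ (-x) :=
    continuous_const.rpow continuous_neg fun _ => Or.inl (by norm_num)
  rw [intervalIntegral.integral_eq_sub_of_hasDerivAt (fun x _ => hd x) (hc.intervalIntegrable _ _)]
  have : 0 ≤ (2 : ℝ) ^ (-b) / Real.log 2 := by positivity
  linarith

/-- A holomorphic function on a half plane that is uniformly close to `1` in a quadrant, with an
error `O(2 ^ (-Re s))`, has a small mean value of `log ‖f‖` on vertical segments. -/
theorem abs_integral_log_norm_le {f : ℂ → ℂ} {a b A : ℝ}
    (hf : ∀ s : ℂ, a ≤ s.re → b ≤ s.im → DifferentiableAt ℂ f s)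
    (h₁ : ∀ s : ℂ, a ≤ s.re → b ≤ s.im → ‖f s - 1‖ ≤ 1 / 2)
    (h₂ : ∀ s : ℂ, a ≤ s.re → b ≤ s.im → ‖f s - 1‖ ≤ A * 2 ^ (-s.re))
    {σ t₀ T : ℝ} (hσ : a ≤ σ) (ht₀ : b ≤ t₀) (hT : t₀ ≤ T) :
    |∫ t in t₀..T, Real.log ‖f (σ + t * I)‖| ≤ (3 * A / Real.log 2) * 2 ^ (-σ) := by
  have hslit : ∀ s : ℂ, a ≤ s.re → b ≤ s.im → f s ∈ slitPlane := by
    intro s hs hs'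
    left
    have := (abs_re_le_norm (f s - 1)).trans (h₁ s hs hs')
    rw [sub_re, one_re, abs_le] at this
    linarith [this.1]
  have hlog : ∀ s : ℂ, a ≤ s.re → b ≤ s.im → ‖Complex.log (f s)‖ ≤ 3 / 2 * A * 2 ^ (-s.re) := by
    intro s hs hs'
    have := norm_log_one_add_half_le_self (h₁ s hs hs')
    rw [add_sub_cancel] at this
    linarith [h₂ s hs hs']
  have hdiff : ∀ s : ℂ, a ≤ s.re → b ≤ s.im → DifferentiableAt ℂ (fun z => Complex.log (f z)) s :=
    fun s hs hs' => (hf s hs hs').clog (hslit s hs hs')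
  have hcontv : ∀ x : ℝ, a ≤ x → ContinuousOn (fun t : ℝ => Complex.log (f (x + t * I))) (Icc t₀ T) := by
    intro x hx t ht
    have h : ContinuousAt (fun z => Complex.log (f z)) ((x : ℂ) + t * I) :=
      (hdiff _ (by simpa using hx) (by simpa using ht₀.trans ht.1)).continuousAt
    have h' : ContinuousAt (fun t : ℝ => (x : ℂ) + t * I) t := by fun_prop
    exact (ContinuousAt.comp (f := fun t : ℝ => (x : ℂ) + t * I) (g := fun z => Complex.log (f z)) h
      h').continuousWithinAt
  have hre : ∫ t in t₀..T, Real.log ‖f (σ + t * I)‖ =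
      (∫ t in t₀..T, Complex.log (f (σ + t * I))).re := by
    have hi : IntervalIntegrable (fun t : ℝ => Complex.log (f (σ + t * I))) volume t₀ T :=
      ContinuousOn.intervalIntegrable (by rw [uIcc_of_le hT]; exact hcontv σ hσ)
    rw [← reCLM_apply, ← ContinuousLinearMap.intervalIntegral_comp_comm _ hi]
    simp only [reCLM_apply, log_re]
  have hA : 0 ≤ A := by
    have h := (norm_nonneg _).trans (h₂ ⟨σ, t₀⟩ hσ ht₀)
    exact nonneg_of_mul_nonneg_left h (by positivity)
  have hpos2 : ∀ x : ℝ, (0 : ℝ) < 2 ^ (-x) := fun x => by positivity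
  have hhor : ∀ σ' : ℝ, σ ≤ σ' → ∀ t : ℝ, b ≤ t →
      ‖∫ x in σ..σ', Complex.log (f (x + t * I))‖ ≤ 3 / 2 * A * (2 ^ (-σ) / Real.log 2) := by
    intro σ' hσ' t ht
    have hc : Continuous fun x : ℝ => 3 / 2 * A * (2 : ℝ) ^ (-x) :=
      continuous_const.mul (continuous_const.rpow continuous_neg fun _ => Or.inl (by norm_num))
    refine (intervalIntegral.norm_integral_le_of_norm_le (g := fun x => 3 / 2 * A * 2 ^ (-x)) hσ'
      (ae_of_all _ fun x hx => ?_) (hc.intervalIntegrable _ _)).trans ?_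
    · simpa using hlog (x + t * I) (by simpa using hσ.trans hx.1.le) (by simpa using ht)
    · rw [intervalIntegral.integral_const_mul]
      exact mul_le_mul_of_nonneg_left (integral_two_rpow_neg_le σ σ') (by positivity)
  -- Cauchy on `[σ, σ'] × [t₀, T]`: the horizontal sides give a bound free of `T`, and the only term
  -- with `T - t₀` carries `2 ^ (-σ')`, which vanishes as `σ' → ∞`.
  have hbound : ∀ σ' : ℝ, σ ≤ σ' → ‖∫ t in t₀..T, Complex.log (f (σ + t * I))‖ ≤
      (3 * A / Real.log 2) * 2 ^ (-σ) + 3 / 2 * A * 2 ^ (-σ') * (T - t₀) := by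
    intro σ' hσ'
    have hrc := Complex.integral_boundary_rect_eq_zero_of_differentiableOn
      (fun z => Complex.log (f z)) (⟨σ, t₀⟩ : ℂ) (⟨σ', T⟩ : ℂ) (by
        intro z hz
        rw [mem_reProdIm, uIcc_of_le hσ', uIcc_of_le hT] at hz
        exact (hdiff z (hσ.trans hz.1.1) (ht₀.trans hz.2.1)).differentiableWithinAt)
    simp only at hrc
    have hright : ‖∫ t in t₀..T, Complex.log (f (σ' + t * I))‖ ≤ 3 / 2 * A * 2 ^ (-σ') * (T - t₀) := by
      rw [← abs_of_nonneg (sub_nonneg.2 hT)]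
      refine intervalIntegral.norm_integral_le_of_norm_le_const fun t ht => ?_
      rw [uIoc_of_le hT] at ht
      simpa using hlog (σ' + t * I) (by simpa using hσ.trans hσ') (by simpa using ht₀.trans ht.1.le)
    have e : I • (∫ t in t₀..T, Complex.log (f (σ + t * I))) =
        (∫ x in σ..σ', Complex.log (f (x + t₀ * I))) - (∫ x in σ..σ', Complex.log (f (x + T * I))) +
          I • ∫ t in t₀..T, Complex.log (f (σ' + t * I)) := by
      linear_combination -hrc
    have en : ‖∫ t in t₀..T, Complex.log (f (σ + t * I))‖ =
        ‖I • ∫ t in t₀..T, Complex.log (f (σ + t * I))‖ := by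
      rw [norm_smul, norm_I, one_mul]
    rw [en, e]
    refine (norm_add_le _ _).trans (add_le_add ((norm_sub_le _ _).trans ?_) ?_)
    · refine (add_le_add (hhor σ' hσ' t₀ ht₀) (hhor σ' hσ' T (ht₀.trans hT))).trans (le_of_eq ?_)
      ring
    · rwa [norm_smul, norm_I, one_mul]
  have hlim : Tendsto (fun σ' : ℝ => (3 * A / Real.log 2) * 2 ^ (-σ) + 3 / 2 * A * 2 ^ (-σ') * (T - t₀))
      atTop (𝓝 ((3 * A / Real.log 2) * 2 ^ (-σ) + 3 / 2 * A * 0 * (T - t₀))) := by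
    refine tendsto_const_nhds.add ((tendsto_const_nhds.mul ?_).mul tendsto_const_nhds)
    exact (tendsto_rpow_atBot_of_base_gt_one 2 (by norm_num)).comp tendsto_neg_atTop_atBot
  rw [mul_zero, zero_mul, add_zero] at hlim
  rw [hre]
  exact (abs_re_le_norm _).trans
    (ge_of_tendsto hlim ((eventually_ge_atTop σ).mono hbound))

/-! ### Logarithmic singularities on compact sets. -/

/-- On a compact set where `f` is analytic and not locally zero, `|log ‖f s‖|` is dominated by a
locally integrable function of `Im s`, outside finitely many values of `Im s`. -/
theorem exists_dominating_log_norm {f : ℂ → ℂ} {K : Set ℂ} (hK : IsCompact K)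
    (hf : ∀ s ∈ K, AnalyticAt ℂ f s) (hf0 : ∀ s ∈ K, ¬ ∀ᶠ z in 𝓝 s, f z = 0) :
    ∃ (Φ : ℝ → ℝ) (E : Set ℝ), E.Finite ∧ (∀ t, 0 ≤ Φ t) ∧
      (∀ a b : ℝ, IntervalIntegrable Φ volume a b) ∧
      ∀ s ∈ K, s.im ∉ E → |Real.log ‖f s‖| ≤ Φ s.im := by
  refine hK.induction_on (p := fun S => ∃ (Φ : ℝ → ℝ) (E : Set ℝ), E.Finite ∧ (∀ t, 0 ≤ Φ t) ∧
      (∀ a b : ℝ, IntervalIntegrable Φ volume a b) ∧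
      ∀ s ∈ S, s.im ∉ E → |Real.log ‖f s‖| ≤ Φ s.im) ?_ ?_ ?_ ?_
  · exact ⟨0, ∅, finite_empty, fun _ => le_rfl, fun _ _ => intervalIntegrable_const, by simp⟩
  · rintro S S' hS ⟨Φ, E, h1, h2, h3, h4⟩
    exact ⟨Φ, E, h1, h2, h3, fun s hs => h4 s (hS hs)⟩
  · rintro S S' ⟨Φ, E, h1, h2, h3, h4⟩ ⟨Φ', E', h1', h2', h3', h4'⟩
    refine ⟨fun t => Φ t + Φ' t, E ∪ E', h1.union h1', fun t => add_nonneg (h2 t) (h2' t),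
      fun a b => (h3 a b).add (h3' a b), ?_⟩
    rintro s (hs | hs) hsE
    · exact (h4 s hs fun h => hsE (Or.inl h)).trans (le_add_of_nonneg_right (h2' _))
    · exact (h4' s hs fun h => hsE (Or.inr h)).trans (le_add_of_nonneg_left (h2 _))
  · intro s₀ hs₀
    -- Locally `f z = (z - s₀) ^ n * g z` with `g s₀ ≠ 0`. As `|Im (z - s₀)| ≤ |z - s₀| < 1`,
    -- passing to imaginary parts only enlarges `|log|`. The height `Im s₀` is excluded because
    -- there the dominating term takes the default value `Real.log 0 = 0`.
    obtain ⟨n, g, hg, hg0, hfg⟩ :=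
      (hf s₀ hs₀).exists_eventuallyEq_pow_smul_nonzero_iff.2 (hf0 s₀ hs₀)
    have hlogc : ContinuousAt (fun z => |Real.log ‖g z‖|) s₀ :=
      ((hg.continuousAt.norm).log (norm_ne_zero_iff.2 hg0)).abs
    have hg1 : ∀ᶠ z in 𝓝 s₀, g z ≠ 0 := hg.continuousAt.eventually_ne hg0
    have hb : ∀ᶠ z in 𝓝 s₀, |Real.log ‖g z‖| < |Real.log ‖g s₀‖| + 1 :=
      hlogc.eventually_lt continuousAt_const (by simp)
    have hball : ∀ᶠ z in 𝓝 s₀, ‖z - s₀‖ < 1 := by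
      filter_upwards [Metric.ball_mem_nhds s₀ one_pos] with z hz
      rwa [← dist_eq_norm]
    refine ⟨_, mem_nhdsWithin_of_mem_nhds (hfg.and (hg1.and (hb.and hball))),
      fun t => n * |Real.log (t - s₀.im)| + (|Real.log ‖g s₀‖| + 1), {s₀.im}, finite_singleton _,
      fun t => by positivity, fun a b => ?_, ?_⟩
    · refine IntervalIntegrable.add (IntervalIntegrable.const_mul (IntervalIntegrable.abs ?_) _)
        intervalIntegrable_const
      have := (intervalIntegral.intervalIntegrable_log' (a := a - s₀.im) (b := b - s₀.im)).comp_sub_right s₀.im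
      simpa using this
    · rintro z ⟨hz1, hz2, hz3, hz4⟩ hzE
      have him : 0 < |z.im - s₀.im| := abs_pos.2 (sub_ne_zero.2 hzE)
      have him' : |z.im - s₀.im| ≤ ‖z - s₀‖ := by
        rw [← sub_im]
        exact abs_im_le_norm _
      have hpos : 0 < ‖z - s₀‖ := him.trans_le him'
      rw [hz1, norm_smul, norm_pow, Real.log_mul (by positivity) (norm_ne_zero_iff.2 hz2),
        Real.log_pow]
      refine (abs_add_le _ _).trans (add_le_add ?_ hz3.le)
      rw [abs_mul, Nat.abs_cast]
      refine mul_le_mul_of_nonneg_left ?_ (Nat.cast_nonneg n)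
      rw [← Real.log_abs (z.im - s₀.im), abs_of_nonpos (Real.log_nonpos hpos.le hz4.le),
        abs_of_nonpos (Real.log_nonpos him.le (him'.trans hz4.le))]
      exact neg_le_neg (Real.log_le_log him him')

/-! ### Moving the line past an integer. -/

/-- The denominator vanishes only at integers. For `x = n + (1 + i)z`, the strip covers the slanted
lines crossing the real axis between `n - 1` and `n + 1`, where `n` is the only integer. -/
theorem eq_zero_of_cexp_sub_cexp_neg_eq_zero {n : ℕ} {z : ℂ} (hz : |z.im| < 1 / 2)
    (h : cexp ((Real.pi : ℂ) * I * (n + (1 + I) * z)) -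
      cexp (-((Real.pi : ℂ) * I * (n + (1 + I) * z))) = 0) : z = 0 := by
  obtain ⟨k, hk⟩ := Complex.exp_eq_exp_iff_exists_int.1 (sub_eq_zero.1 h)
  have hx : (n : ℂ) + (1 + I) * z = k := by
    have h2 : (2 * Real.pi * I : ℂ) ≠ 0 := two_pi_I_ne_zero
    apply mul_left_cancel₀ h2
    linear_combination hk
  have hre := congrArg Complex.re hx
  have him := congrArg Complex.im hx
  simp at hre him
  rw [abs_lt] at hz
  have h1 : (-1 : ℝ) < ((k - n : ℤ) : ℝ) := by push_cast; linarith [hz.2]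
  have h2 : ((k - n : ℤ) : ℝ) < 1 := by push_cast; linarith [hz.1]
  have h3 : k = n := by
    have h1' : -1 < k - (n : ℤ) := by exact_mod_cast h1
    have h2' : k - (n : ℤ) < 1 := by exact_mod_cast h2
    omega
  rw [h3, Int.cast_natCast] at hre
  apply Complex.ext <;> simp <;> linarith

/-- The two exponentials have moduli `e ^ (∓π Im x)`, which differ by `2 sinh(π |Im x|)`. Valid on
every line, this gives the `1 / |Re z|` decay at the ends of the strip. -/
theorem abs_im_le_norm_cexp_sub_cexp_neg (x : ℂ) :
    2 * Real.pi * |x.im| ≤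
      ‖cexp ((Real.pi : ℂ) * I * x) - cexp (-((Real.pi : ℂ) * I * x))‖ := by
  refine le_trans ?_ (abs_norm_sub_norm_le _ _)
  rw [norm_exp, norm_exp]
  have e1 : ((Real.pi : ℂ) * I * x).re = -(Real.pi * x.im) := by simp
  rw [neg_re, e1, neg_neg, abs_sub_comm]
  have e2 : Real.exp (Real.pi * x.im) - Real.exp (-(Real.pi * x.im)) =
      2 * Real.sinh (Real.pi * x.im) := by
    rw [Real.sinh_eq]
    ring
  have e3 := Real.self_le_sinh_iff.2 (abs_nonneg (Real.pi * x.im))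
  rw [e2, abs_mul, Real.abs_sinh, abs_two]
  rw [abs_mul, abs_of_pos Real.pi_pos] at e3 ⊢
  linarith

/-- The contribution of the pole at the integer `m + 1`. -/
theorem slantIntegral_succ_sub (m : ℕ) {s : ℂ} (hs : 0 ≤ s.re) :
    slantIntegral (m + 1) s - slantIntegral m s = ((m + 1 : ℕ) : ℂ) ^ (-s) := by
  set n : ℕ := m + 1 with hn
  have hnm : (n : ℝ) = m + 1 := by simp [hn]
  have hn1 : (1 : ℝ) ≤ n := by rw [hnm]; linarith [Nat.cast_nonneg (α := ℝ) m]
  -- In the coordinate `x = n + (1 + i)z` the lines through `n + 1/2` and `n - 1/2 = m + 1/2` become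
  -- `Im z = -1/4` and `Im z = 1/4`. Dividing the numerator `N` by `dslope D 0` isolates the simple
  -- pole at `0`; the signs `(-1) ^ n` from `N 0` and `D' 0` cancel because `n² ≡ n` mod `2`.
  set D : ℂ → ℂ := fun z => cexp ((Real.pi : ℂ) * I * (n + (1 + I) * z)) -
      cexp (-((Real.pi : ℂ) * I * (n + (1 + I) * z))) with hD
  set N : ℂ → ℂ := fun z => ((n : ℂ) + (1 + I) * z) ^ (-s) *
    cexp ((Real.pi : ℂ) * I * (n + (1 + I) * z) ^ 2) * (1 + I) with hN
  set U : Set ℂ := {z | |z.im| < 1 / 2} with hU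
  have hUo : IsOpen U := isOpen_lt (by fun_prop) continuous_const
  have hexpn : cexp ((Real.pi : ℂ) * I * n) = (-1) ^ n := by
    rw [mul_comm, Complex.exp_nat_mul, exp_pi_mul_I]
  have hexpn' : cexp (-((Real.pi : ℂ) * I * n)) = (-1) ^ n := by
    rw [Complex.exp_neg, hexpn, ← inv_pow]
    norm_num
  have hexpnn : cexp ((Real.pi : ℂ) * I * n ^ 2) = (-1) ^ n := by
    rw [pow_two, ← mul_assoc, mul_comm, Complex.exp_nat_mul, hexpn, ← pow_mul]
    rcases Nat.even_or_odd n with h | h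
    · rw [h.neg_one_pow, (h.mul_right n).neg_one_pow]
    · rw [h.neg_one_pow, (h.mul h).neg_one_pow]
  have hD0 : D 0 = 0 := by
    simp only [hD, mul_zero, add_zero, hexpn, hexpn', sub_self]
  have hDd : HasDerivAt D (2 * Real.pi * I * (1 + I) * (-1) ^ n) 0 := by
    have h1 : HasDerivAt (fun z : ℂ => (Real.pi : ℂ) * I * (n + (1 + I) * z))
        (Real.pi * I * ((1 + I) * 1)) 0 :=
      (((hasDerivAt_id (0 : ℂ)).const_mul (1 + I)).const_add (n : ℂ)).const_mul _
    refine (h1.cexp.sub h1.neg.cexp).congr_deriv ?_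
    simp only [mul_zero, add_zero, Pi.neg_apply, hexpn, hexpn']
    ring
  have hDdiff : Differentiable ℂ D := by
    simp only [hD]
    fun_prop
  have hdsd : Differentiable ℂ (dslope D 0) := by
    rw [← differentiableOn_univ, Complex.differentiableOn_dslope univ_mem]
    exact hDdiff.differentiableOn
  have hds0 : dslope D 0 0 = 2 * Real.pi * I * (1 + I) * (-1) ^ n := by
    rw [dslope_same, hDd.deriv]
  have hI : (1 + I : ℂ) ≠ 0 := by
    intro h
    have := congrArg Complex.re h
    simp at this
  have hds : ∀ z, z * dslope D 0 z = D z := by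
    intro z
    have := sub_smul_dslope D 0 z
    rwa [sub_zero, smul_eq_mul, hD0, sub_zero] at this
  have hdsne : ∀ z ∈ U, dslope D 0 z ≠ 0 := by
    intro z hz h
    have hz0 : z = 0 := by
      apply eq_zero_of_cexp_sub_cexp_neg_eq_zero (n := n) hz
      change D z = 0
      rw [← hds, h, mul_zero]
    rw [hz0, hds0] at h
    have h1 : ((-1 : ℂ)) ^ n ≠ 0 := pow_ne_zero _ (by norm_num)
    exact mul_ne_zero (mul_ne_zero two_pi_I_ne_zero hI) h1 h
  have hslit : ∀ z ∈ U, (n : ℂ) + (1 + I) * z ∈ slitPlane := by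
    intro z hz
    have hz' := abs_lt.1 (show |z.im| < 1 / 2 from hz)
    rw [mem_slitPlane_iff]
    by_cases h : ((n : ℂ) + (1 + I) * z).im = 0
    · left
      simp at h ⊢
      linarith [hz'.2]
    · exact Or.inr h
  have hNd : DifferentiableOn ℂ N U := by
    intro z hz
    apply DifferentiableAt.differentiableWithinAt
    simp only [hN]
    refine DifferentiableAt.mul_const (DifferentiableAt.mul ?_ (by fun_prop)) _
    exact DifferentiableAt.cpow (by fun_prop) (by fun_prop) (hslit z hz)
  have hquot : ∀ z, N z / dslope D 0 z / z =
      auxIntegrand s (n + (1 + I) * z) * (1 + I) := by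
    intro z
    rw [div_div, mul_comm _ z, hds]
    simp only [hN, hD, auxIntegrand]
    ring
  have hslant : ∀ v w : ℝ, (n : ℂ) + (1 + I) * (v + w * I) = slant (n - 2 * w) (v + w) := by
    intro v w
    simp only [slant]
    push_cast
    linear_combination (w : ℂ) * I_sq
  have hlow : ∀ v : ℝ, N (v + (-(1 / 4) : ℝ) * I) / dslope D 0 (v + (-(1 / 4) : ℝ) * I) /
      (v + (-(1 / 4) : ℝ) * I) = auxIntegrand s (slant (n + 1 / 2) (v - 1 / 4)) * (1 + I) := by
    intro v
    rw [hquot, hslant]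
    ring_nf
  have hupp : ∀ v : ℝ, N (v + (1 / 4 : ℝ) * I) / dslope D 0 (v + (1 / 4 : ℝ) * I) /
      (v + (1 / 4 : ℝ) * I) = auxIntegrand s (slant (m + 1 / 2) (v + 1 / 4)) * (1 + I) := by
    intro v
    rw [hquot, hslant, hnm]
    ring_nf
  have key := integral_line_sub_integral_line_of_simple_pole (g := fun z => N z / dslope D 0 z)
    (c := 1 / 4) (by norm_num) hUo (fun z hz => lt_of_le_of_lt hz (by norm_num))
    (hNd.div hdsd.differentiableOn hdsne)
    (by
      simp_rw [hlow]
      exact ((integrable_auxIntegrand_slant n hs).comp_sub_right (1 / 4)).mul_const _)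
    (by
      simp_rw [hupp]
      exact ((integrable_auxIntegrand_slant m hs).comp_add_right (1 / 4)).mul_const _)
    (K := (1 / 4 : ℝ) ^ (-s.re) *
      Real.exp (Real.pi * |s.im| + Real.pi * (n + 1 / 2) ^ 2 / 2) * 2) (by
      intro z hz hz'
      rw [abs_le] at hz
      have hzx : (n : ℂ) + (1 + I) * z = slant (n - 2 * z.im) (z.re + z.im) := by
        rw [← hslant, re_add_im]
      have ha : 0 < n - 2 * z.im := by linarith
      rw [hquot, hzx, auxIntegrand, div_mul_eq_mul_div, norm_div, norm_mul, norm_mul,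
        norm_cpow_neg_slant ha, norm_cexp_pi_mul_sq, slant_re, slant_im, mul_assoc (_ ^ _),
        ← Real.exp_add]
      have hden := abs_im_le_norm_cexp_sub_cexp_neg (slant (n - 2 * z.im) (z.re + z.im))
      rw [slant_im] at hden
      have hre : |z.re| ≤ |z.re + z.im| + 1 / 4 := by
        have h1 : |z.re| ≤ |z.re + z.im| + |z.im| := by
          have := abs_sub (z.re + z.im) z.im
          rwa [add_sub_cancel_right] at this
        linarith [abs_le.2 hz]
      have hexp := mul_arg_slant_sub_le_of_abs (n - 2 * z.im) s.im (z.re + z.im)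
      have h1 : ‖(1 + I : ℂ)‖ ≤ 2 := (norm_add_le _ _).trans (by simp; norm_num)
      have hpi := Real.pi_gt_three
      have hbase : (1 / 4 : ℝ) ≤ ‖slant (n - 2 * z.im) (z.re + z.im)‖ := by
        refine le_trans ?_ (le_norm_slant _ _)
        rw [le_div_iff₀ (by positivity)]
        nlinarith [Real.sqrt_two_lt_three_halves, Real.sqrt_nonneg 2]
      gcongr ?_ * Real.exp ?_ * ?_ / ?_
      · exact Real.rpow_le_rpow_of_nonpos (by norm_num) hbase (by linarith)
      · have : (n - 2 * z.im) ^ 2 ≤ ((n : ℝ) + 1 / 2) ^ 2 := by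
          gcongr
          linarith
        nlinarith
      · refine le_trans ?_ hden
        nlinarith [abs_nonneg (z.re + z.im)])
  simp_rw [hlow, hupp] at key
  rw [integral_sub_right_eq_self
      (fun v : ℝ => auxIntegrand s (slant (n + 1 / 2) v) * (1 + I)) (1 / 4),
    integral_add_right_eq_self
      (fun v : ℝ => auxIntegrand s (slant (m + 1 / 2) v) * (1 + I)) (1 / 4)] at key
  change slantIntegral n s - slantIntegral m s = _ at key
  rw [key, hds0]
  simp only [hN, mul_zero, add_zero, hexpnn]
  have h1 : ((-1 : ℂ)) ^ n ≠ 0 := pow_ne_zero _ (by norm_num)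
  have h2 := two_pi_I_ne_zero
  rw [mul_div_assoc', div_eq_iff (mul_ne_zero (mul_ne_zero h2 hI) h1)]
  ring

theorem riemannAux_eq_sum_sub (m : ℕ) {s : ℂ} (hs : 0 ≤ s.re) :
    riemannAux s = ∑ k ∈ Finset.range m, ((k + 1 : ℕ) : ℂ) ^ (-s) - slantIntegral m s := by
  induction m with
  | zero => rw [riemannAux_eq_neg_slantIntegral, Finset.sum_range_zero, zero_sub]
  | succ m ih =>
    rw [ih, Finset.sum_range_succ, ← slantIntegral_succ_sub m hs]
    ring

/-! ### Holomorphy of `riemannAux`. -/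

/-- Differentiation under the integral sign. The logarithm in the derivative is never estimated: a
Cauchy estimate on circles of radius `δ = Re s / 3` bounds the derivative by the integrand itself,
and two such radii stay inside `Re > 0`. -/
theorem differentiableAt_riemannAux {s : ℂ} (hs : 0 < s.re) : DifferentiableAt ℂ riemannAux s := by
  have e : riemannAux = fun s => -slantIntegral 0 s := funext riemannAux_eq_neg_slantIntegral
  rw [e]
  apply DifferentiableAt.neg
  set δ : ℝ := s.re / 3 with hδ
  have hδ0 : 0 < δ := by positivity
  set B : ℝ := (((0 : ℕ) + 1 / 2 : ℝ) / √2) ^ (-(2 * s.re)) *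
    Real.exp (Real.pi * (|s.im| + s.re) + Real.pi * ((0 : ℕ) + 1 / 2) ^ 2 / 2) with hB
  have hx : ∀ v, slant ((0 : ℕ) + 1 / 2) v ∈ slitPlane := slant_mem_slitPlane (by norm_num)
  have hbound : ∀ w : ℂ, ‖w - s‖ < 2 * δ → ∀ v : ℝ,
      ‖auxIntegrand w (slant ((0 : ℕ) + 1 / 2) v)‖ ≤ B * (1 + v ^ 2)⁻¹ := by
    intro w hw v
    have h1 := abs_le.1 ((abs_re_le_norm _).trans hw.le)
    have h2 := (abs_im_le_norm _).trans hw.le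
    rw [sub_re] at h1
    rw [sub_im] at h2
    have h3 : |w.im| ≤ |s.im| + s.re := by
      have := abs_add_le (w.im - s.im) s.im
      rw [sub_add_cancel] at this
      linarith
    refine (norm_auxIntegrand_le 0 (by linarith [h1.1]) v
      (mul_arg_slant_sub_le_of_abs _ _ v)).trans ?_
    rw [hB]
    gcongr ?_ * Real.exp (Real.pi * ?_ + _) * _
    refine Real.rpow_le_rpow_of_exponent_ge (by positivity) ?_ (by linarith [h1.2])
    rw [div_le_one (by positivity)]
    have h4 : (1 : ℝ) ≤ √2 := Real.one_le_sqrt.2 (by norm_num)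
    push_cast
    linarith
  have hder : ∀ w : ℂ, ∀ v : ℝ, HasDerivAt
      (fun w => auxIntegrand w (slant ((0 : ℕ) + 1 / 2) v) * (1 + I))
      (-Complex.log (slant ((0 : ℕ) + 1 / 2) v) *
        (auxIntegrand w (slant ((0 : ℕ) + 1 / 2) v) * (1 + I))) w := by
    intro w v
    have h := (((hasDerivAt_id w).neg.const_cpow (c := slant ((0 : ℕ) + 1 / 2) v)
      (Or.inl (slitPlane_ne_zero (hx v)))).mul_const
        (cexp ((Real.pi : ℂ) * I * slant ((0 : ℕ) + 1 / 2) v ^ 2))).div_const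
        (cexp ((Real.pi : ℂ) * I * slant ((0 : ℕ) + 1 / 2) v) -
          cexp (-((Real.pi : ℂ) * I * slant ((0 : ℕ) + 1 / 2) v)))
    refine (h.mul_const (1 + I)).congr_deriv ?_
    simp only [auxIntegrand, Pi.neg_apply, id]
    ring
  have h1I : ‖(1 + I : ℂ)‖ ≤ 2 := (norm_add_le _ _).trans (by simp; norm_num)
  have hmain := hasDerivAt_integral_of_dominated_loc_of_deriv_le (μ := volume)
    (F := fun w v => auxIntegrand w (slant ((0 : ℕ) + 1 / 2) v) * (1 + I))
    (F' := fun w v => -Complex.log (slant ((0 : ℕ) + 1 / 2) v) *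
      (auxIntegrand w (slant ((0 : ℕ) + 1 / 2) v) * (1 + I)))
    (x₀ := s) (s := Metric.ball s δ) (bound := fun v => (2 * B / δ) * (1 + v ^ 2)⁻¹)
    (Metric.ball_mem_nhds s hδ0)
    (Eventually.of_forall fun w =>
      ((continuous_auxIntegrand_slant 0 w).mul continuous_const).aestronglyMeasurable)
    ((integrable_auxIntegrand_slant 0 hs.le).mul_const _)
    ((((continuous_slant _).clog hx).neg.mul
      ((continuous_auxIntegrand_slant 0 s).mul continuous_const)).aestronglyMeasurable)
    (ae_of_all _ fun v w hw => by
      rw [← (hder w v).deriv]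
      have := Complex.norm_deriv_le_of_forall_mem_sphere_norm_le (c := w) (C := 2 * B * (1 + v ^ 2)⁻¹)
        (f := fun w => auxIntegrand w (slant ((0 : ℕ) + 1 / 2) v) * (1 + I)) hδ0
        (Differentiable.diffContOnCl fun w => (hder w v).differentiableAt) (by
          intro z hz
          rw [norm_mul]
          have hz' : ‖z - s‖ < 2 * δ := by
            rw [mem_sphere_iff_norm] at hz
            rw [mem_ball_iff_norm] at hw
            have := norm_add_le (z - w) (w - s)
            rw [sub_add_sub_cancel] at this
            linarith
          have h0 := (norm_nonneg _).trans (hbound z hz' v)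
          refine (mul_le_mul (hbound z hz' v) h1I (norm_nonneg _) h0).trans (le_of_eq ?_)
          ring)
      refine this.trans (le_of_eq ?_)
      ring)
    (integrable_inv_one_add_sq.const_mul _)
    (ae_of_all _ fun v w _ => hder w v)
  exact hmain.2.differentiableAt

/-! ### Approximation of `riemannAux` by `1`. -/

/-- For `N ≥ 2`, `N ^ (-σ) ≤ 2 ^ (3 - σ) / N³`, and `1 / N³ ≤ 1 / ((N - 1)N(N + 1))` telescopes. -/
theorem norm_sum_range_cpow_sub_one_le (m : ℕ) {s : ℂ} (hs : 3 ≤ s.re) :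
    ‖∑ k ∈ Finset.range (m + 1), ((k + 1 : ℕ) : ℂ) ^ (-s) - 1‖ ≤
      2 ^ (3 - s.re) * (1 / 4 - 1 / (2 * (m + 1) * (m + 2))) := by
  induction m with
  | zero => norm_num
  | succ m ih =>
    rw [Finset.sum_range_succ, add_sub_right_comm]
    refine (norm_add_le _ _).trans ((add_le_add_left ih _).trans ?_)
    set N : ℝ := m + 2 with hN
    have hN2 : 2 ≤ N := by rw [hN]; linarith [Nat.cast_nonneg (α := ℝ) m]
    have e1 : ‖((m + 1 + 1 : ℕ) : ℂ) ^ (-s)‖ = N ^ (-s.re) := by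
      rw [norm_natCast_cpow_of_pos (by omega), neg_re]
      congr 1
      push_cast
      ring
    have e2 : N ^ (-s.re) ≤ 2 ^ (3 - s.re) * (1 / N ^ 3) := by
      have : N ^ (-s.re) = N ^ (3 - s.re) * (1 / N ^ 3) := by
        rw [show -s.re = (3 - s.re) - (3 : ℕ) by push_cast; ring, Real.rpow_sub_natCast (by positivity)]
        ring
      rw [this]
      gcongr ?_ * _
      exact Real.rpow_le_rpow_of_nonpos (by norm_num) hN2 (by linarith)
    have e3 : 1 / N ^ 3 ≤ 1 / (2 * (N - 1) * N) - 1 / (2 * N * (N + 1)) := by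
      have h1 : N - 1 ≠ 0 := by linarith
      have h2 : N + 1 ≠ 0 := by linarith
      have h3 : N ≠ 0 := by linarith
      have : 1 / (2 * (N - 1) * N) - 1 / (2 * N * (N + 1)) = 1 / ((N - 1) * N * (N + 1)) := by
        field_simp
        ring
      rw [this]
      apply one_div_le_one_div_of_le
      · have : 0 < N - 1 := by linarith
        positivity
      · nlinarith
    rw [e1]
    push_cast
    rw [show (m : ℝ) + 1 = N - 1 by rw [hN]; ring, show N - 1 + 1 = N by ring,
      show N - 1 + 2 = N + 1 by ring]
    have h2 : (0 : ℝ) < 2 ^ (3 - s.re) := by positivity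
    nlinarith [mul_le_mul_of_nonneg_left e3 h2.le]

/-- The error constant for the integral along a line slightly to the right of the saddle point. -/
def slantConst : ℝ := 2 * Real.pi * Real.exp (66 * Real.pi)

/-- With saddle point `η = √(t/2π)`, the line passes through `a = ⌊η⌋ + 7/2`. The offset ensures `a
≥ 7/2`, so that `a/√2 > 2`, while `a - 7/2 ≤ η` gives `a² - 7a ≤ η²`. -/
theorem norm_riemannAux_sub_one_le {s : ℂ} (hs : 3 ≤ s.re) (ht : 0 ≤ s.im) :
    ‖riemannAux s - 1‖ ≤ 2 * 2 ^ (-s.re) + slantConst *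
      (((⌊√(s.im / (2 * Real.pi))⌋₊ + 3 : ℕ) + 1 / 2 : ℝ) / √2) ^ (-s.re) := by
  set η : ℝ := √(s.im / (2 * Real.pi)) with hη
  have hη0 : 0 ≤ η := Real.sqrt_nonneg _
  have hpi := Real.pi_pos
  have hηt : 2 * Real.pi * η ^ 2 = s.im := by
    rw [hη, Real.sq_sqrt (by positivity)]
    field_simp
  have hf1 := Nat.floor_le hη0
  have hf2 := Nat.lt_floor_add_one η
  rw [riemannAux_eq_sum_sub (⌊η⌋₊ + 2 + 1) (by linarith), sub_right_comm]
  refine (norm_sub_le _ _).trans (add_le_add ?_ ?_)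
  · refine (norm_sum_range_cpow_sub_one_le _ hs).trans ?_
    have e : (2 : ℝ) ^ (3 - s.re) = 8 * 2 ^ (-s.re) := by
      rw [sub_eq_add_neg, Real.rpow_add (by norm_num)]
      norm_num
    have h2 : (0 : ℝ) < 2 ^ (-s.re) := by positivity
    have h3 : 0 ≤ (1 : ℝ) / (2 * ((⌊η⌋₊ + 2 : ℕ) + 1) * ((⌊η⌋₊ + 2 : ℕ) + 2)) := by positivity
    rw [e]
    nlinarith
  · refine norm_slantIntegral_le (⌊η⌋₊ + 3) (by linarith) (M := 66 * Real.pi) ?_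
    apply mul_arg_slant_sub_le
    · push_cast
      linarith
    · exact ht
    · rw [← hηt]
      gcongr
      push_cast
      linarith
    · rw [← hηt]
      push_cast
      gcongr
      nlinarith

theorem slantConst_pos : 0 < slantConst := by
  unfold slantConst
  have := Real.pi_pos
  positivity

theorem norm_riemannAux_sub_one_le_two_rpow {s : ℂ} (hs : 3 ≤ s.re) (ht : 0 ≤ s.im) :
    ‖riemannAux s - 1‖ ≤ (2 + slantConst) * 2 ^ (-s.re) := by
  refine (norm_riemannAux_sub_one_le hs ht).trans ?_
  rw [add_mul]
  have hc := slantConst_pos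
  gcongr 2 * _ + _ * ?_
  refine Real.rpow_le_rpow_of_nonpos (by norm_num) ?_ (by linarith)
  rw [le_div_iff₀ (by positivity)]
  push_cast
  nlinarith [Real.sqrt_two_lt_three_halves, Real.sqrt_nonneg 2,
    Nat.cast_nonneg (α := ℝ) ⌊√(s.im / (2 * Real.pi))⌋₊]

/-- `slantConst` is huge, so the `2 ^ (-σ)` bound alone does not keep `R` near `1` for moderate `σ`.
Large `t` does, since the base `a/√2` grows with `η`. -/
theorem exists_norm_riemannAux_sub_one_le_half :
    ∃ t₁ : ℝ, 1 ≤ t₁ ∧ ∀ s : ℂ, 3 ≤ s.re → t₁ ≤ s.im → ‖riemannAux s - 1‖ ≤ 1 / 2 := by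
  have hc := slantConst_pos
  have hpi := Real.pi_pos
  -- Chosen so that `η ≥ 8 * slantConst`: the integral then contributes at most `slantConst * (2 /
  -- η) ≤ 1/4`, and the sum at most `2 * 2 ^ (-3) = 1/4`.
  refine ⟨2 * Real.pi * (8 * slantConst) ^ 2 + 1, by
    linarith [show 0 ≤ 2 * Real.pi * (8 * slantConst) ^ 2 by positivity], fun s hs ht => ?_⟩
  have ht0 : 0 ≤ s.im := by
    linarith [show 0 ≤ 2 * Real.pi * (8 * slantConst) ^ 2 by positivity]
  refine (norm_riemannAux_sub_one_le hs ht0).trans ?_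
  set η : ℝ := √(s.im / (2 * Real.pi)) with hη
  have hη1 : 8 * slantConst ≤ η := by
    apply Real.le_sqrt_of_sq_le
    rw [le_div_iff₀ (by positivity)]
    linarith
  have hf := Nat.lt_floor_add_one η
  have hη0 : 0 < η := by linarith
  have h2 : (2 : ℝ) ^ (-s.re) ≤ 1 / 8 := by
    calc (2 : ℝ) ^ (-s.re) ≤ 2 ^ (-3 : ℝ) :=
          Real.rpow_le_rpow_of_exponent_le (by norm_num) (by linarith)
      _ = 1 / 8 := by
        rw [Real.rpow_neg (by norm_num)]
        norm_num
  set b : ℝ := ((⌊η⌋₊ + 3 : ℕ) + 1 / 2 : ℝ) / √2 with hb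
  have hsq := Real.sqrt_two_lt_three_halves
  have hb1 : 1 ≤ b ∧ η / 2 ≤ b := by
    rw [hb, le_div_iff₀ (by positivity), le_div_iff₀ (by positivity)]
    push_cast
    constructor <;> nlinarith [Nat.cast_nonneg (α := ℝ) ⌊η⌋₊]
  have h3 : b ^ (-s.re) ≤ 2 / η := by
    calc b ^ (-s.re) ≤ b ^ (-1 : ℝ) := Real.rpow_le_rpow_of_exponent_le hb1.1 (by linarith)
      _ = b⁻¹ := Real.rpow_neg_one b
      _ ≤ (η / 2)⁻¹ := by gcongr; exact hb1.2
      _ = 2 / η := inv_div _ _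
  have h4 : slantConst * b ^ (-s.re) ≤ 1 / 4 := by
    calc slantConst * b ^ (-s.re) ≤ slantConst * (2 / η) := by gcongr
      _ ≤ 1 / 4 := by
        rw [mul_div_assoc', div_le_iff₀ hη0]
        linarith
  linarith

/-! ### Integrability and local bounds for `log ‖riemannAux‖`. -/

theorem isOpen_re_pos : IsOpen {s : ℂ | 0 < s.re} := isOpen_lt continuous_const continuous_re

theorem analyticOnNhd_riemannAux : AnalyticOnNhd ℂ riemannAux {s | 0 < s.re} :=
  DifferentiableOn.analyticOnNhd
    (fun _ hs => (differentiableAt_riemannAux hs).differentiableWithinAt) isOpen_re_pos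

theorem not_eventually_riemannAux_eq_zero {s : ℂ} (hs : 0 < s.re) :
    ¬ ∀ᶠ z in 𝓝 s, riemannAux z = 0 := by
  intro h
  obtain ⟨t₁, -, ht⟩ := exists_norm_riemannAux_sub_one_le_half
  have h0 := analyticOnNhd_riemannAux.eqOn_zero_of_preconnected_of_eventuallyEq_zero
    (convex_halfSpace_re_gt 0).isPreconnected hs h
  have h1 := ht ⟨3, t₁⟩ le_rfl le_rfl
  have h2 : riemannAux ⟨3, t₁⟩ = 0 := h0 (show (0 : ℝ) < 3 by norm_num)
  rw [h2] at h1
  norm_num at h1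

theorem intervalIntegrable_log_norm_riemannAux {σ : ℝ} (hσ : 0 < σ) (a b : ℝ) :
    IntervalIntegrable (fun t : ℝ => Real.log ‖riemannAux (σ + t * I)‖) volume a b := by
  refine MeromorphicOn.intervalIntegrable_log_norm (f := fun t : ℝ => riemannAux (σ + t * I))
    fun t _ => AnalyticAt.meromorphicAt ?_
  have h1 : AnalyticAt ℝ (fun t : ℝ => (σ : ℂ) + t * I) t :=
    analyticAt_const.add ((ofRealCLM.analyticAt t).mul analyticAt_const)
  have h2 : AnalyticAt ℂ riemannAux ((σ : ℂ) + t * I) :=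
    analyticOnNhd_riemannAux _ (by simpa using hσ)
  exact AnalyticAt.comp (f := fun t : ℝ => (σ : ℂ) + t * I) (h2.restrictScalars (𝕜 := ℝ)) h1

/-- Zeros may lie on or near the segment for some `σ`. The dominating function depends on `Im s`
alone, which makes the bound uniform in `σ`. -/
theorem exists_abs_integral_log_norm_riemannAux_le {a b c d : ℝ} (ha : 0 < a) :
    ∃ M : ℝ, 0 ≤ M ∧ ∀ σ ∈ Icc a b, ∀ t₀ T : ℝ, c ≤ t₀ → t₀ ≤ T → T ≤ d →
      |∫ t in t₀..T, Real.log ‖riemannAux (σ + t * I)‖| ≤ M := by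
  have hK : IsCompact (Icc a b ×ℂ Icc c d) := isCompact_Icc.reProdIm isCompact_Icc
  have hpos : ∀ s ∈ Icc a b ×ℂ Icc c d, 0 < s.re := fun s hs => ha.trans_le hs.1.1
  obtain ⟨Φ, E, hE, hΦ0, hΦi, hΦ⟩ := exists_dominating_log_norm hK
    (fun s hs => analyticOnNhd_riemannAux s (hpos s hs))
    (fun s hs => not_eventually_riemannAux_eq_zero (hpos s hs))
  refine ⟨|∫ t in c..d, Φ t|, abs_nonneg _, fun σ hσ t₀ T ht₀ hT hTd => ?_⟩
  have hae : ∀ᵐ t : ℝ, t ∉ E := measure_eq_zero_iff_ae_notMem.1 (hE.measure_zero volume)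
  calc |∫ t in t₀..T, Real.log ‖riemannAux (σ + t * I)‖|
      ≤ ∫ t in t₀..T, Φ t := by
        rw [← Real.norm_eq_abs]
        refine intervalIntegral.norm_integral_le_of_norm_le hT ?_ (hΦi _ _)
        filter_upwards [hae] with t htE ht
        have := hΦ (σ + t * I) ⟨by simpa using hσ, by
          simpa using ⟨ht₀.trans ht.1.le, ht.2.trans hTd⟩⟩ (by simpa using htE)
        simpa using this
    _ ≤ ∫ t in c..d, Φ t :=
        intervalIntegral.integral_mono_interval ht₀ hT hTd (ae_of_all _ hΦ0) (hΦi _ _)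
    _ ≤ |∫ t in c..d, Φ t| := le_abs_self _

end

/-! ### Assembling the estimate. -/

theorem theorem3 (σ₁ : ℝ) (hσ₁ : 3 < σ₁) :
    ∃ C : ℝ, ∀ σ : ℝ, σ₁ ≤ σ → ∀ t₀ T : ℝ, 1 ≤ t₀ → t₀ < T →
      IntervalIntegrable (fun t : ℝ => Real.log ‖riemannAux ((σ : ℂ) + (t : ℂ) * Complex.I)‖)
        MeasureTheory.volume t₀ T ∧
      |∫ t in t₀..T, Real.log ‖riemannAux ((σ : ℂ) + (t : ℂ) * Complex.I)‖| ≤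
        C * (2 : ℝ) ^ (-σ) := by
  obtain ⟨t₁, ht₁, hhalf⟩ := exists_norm_riemannAux_sub_one_le_half
  set A : ℝ := 2 + slantConst with hA
  have hA2 : 2 < A := by linarith [slantConst_pos]
  have hlog2 : 0 < Real.log 2 := Real.log_pos (by norm_num)
  set C₁ : ℝ := 3 * A / Real.log 2 with hC₁
  have hC₁0 : 0 ≤ C₁ := by positivity
  have hpow : ∀ σ : ℝ, (0 : ℝ) < 2 ^ (-σ) := fun σ => by positivity
  -- To the right of `σ₂` the bound `|R - 1| ≤ 1/2` holds for all `t ≥ 1`, so no splitting in `t` is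
  -- needed there.
  obtain ⟨σ₂, hσ₂, hσ₂A⟩ : ∃ σ₂ : ℝ, 3 ≤ σ₂ ∧ A * (2 : ℝ) ^ (-σ₂) ≤ 1 / 2 := by
    have h : Filter.Tendsto (fun x : ℝ => A * (2 : ℝ) ^ (-x)) Filter.atTop (nhds (A * 0)) :=
      ((tendsto_rpow_atBot_of_base_gt_one 2 (by norm_num)).comp
        Filter.tendsto_neg_atTop_atBot).const_mul A
    rw [mul_zero] at h
    obtain ⟨x, hx, hx'⟩ := ((Filter.eventually_ge_atTop (3 : ℝ)).and
      (h.eventually_le_const (show (0 : ℝ) < 1 / 2 by norm_num))).exists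
    exact ⟨x, hx, hx'⟩
  obtain ⟨M, hM0, hM⟩ := exists_abs_integral_log_norm_riemannAux_le (a := σ₁) (b := σ₂) (c := 1)
    (d := t₁) (by linarith)
  -- The factor `2 ^ σ₂` turns the constant `M` into a multiple of `2 ^ (-σ)` when `σ ≤ σ₂`.
  refine ⟨C₁ + M * 2 ^ σ₂, fun σ hσ t₀ T ht₀ hT => ?_⟩
  have hσ0 : 0 < σ := by linarith
  have hii := fun a b => intervalIntegrable_log_norm_riemannAux hσ0 a b
  refine ⟨hii _ _, ?_⟩
  have hM2 : 0 ≤ M * 2 ^ σ₂ * 2 ^ (-σ) := by positivity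
  rcases le_total σ₂ σ with h | h
  · have := abs_integral_log_norm_le (f := riemannAux) (a := σ₂) (b := 1) (A := A)
      (fun s hs _ => differentiableAt_riemannAux (by linarith))
      (fun s hs ht => (norm_riemannAux_sub_one_le_two_rpow (by linarith) (by linarith)).trans <|
        (mul_le_mul_of_nonneg_left (Real.rpow_le_rpow_of_exponent_le (by norm_num)
          (by linarith)) (by linarith)).trans hσ₂A)
      (fun s hs ht => norm_riemannAux_sub_one_le_two_rpow (by linarith) (by linarith))
      h ht₀ hT.le
    linarith
  · have hfar : ∀ p, t₁ ≤ p → p ≤ T → |∫ t in p..T, Real.log ‖riemannAux (σ + t * Complex.I)‖| ≤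
        C₁ * 2 ^ (-σ) := fun p hp hpT =>
      abs_integral_log_norm_le (f := riemannAux) (a := σ₁) (b := t₁) (A := A)
        (fun s hs _ => differentiableAt_riemannAux (by linarith))
        (fun s hs ht => hhalf s (by linarith) ht)
        (fun s hs ht => norm_riemannAux_sub_one_le_two_rpow (by linarith) (by linarith))
        hσ hp hpT
    have hM' : M ≤ M * 2 ^ σ₂ * 2 ^ (-σ) := by
      rw [mul_assoc, ← Real.rpow_add (by norm_num)]
      exact le_mul_of_one_le_right hM0 (Real.one_le_rpow (by norm_num) (by linarith))
    have hC₁σ : 0 ≤ C₁ * 2 ^ (-σ) := by positivity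
    rw [add_mul]
    -- The segment is cut at height `t₁`: compactness handles the part below, Cauchy's theorem the
    -- part above.
    rcases le_total t₁ t₀ with h1 | h1
    · linarith [hfar t₀ h1 hT.le]
    rcases le_total T t₁ with h2 | h2
    · linarith [hM σ ⟨hσ, h⟩ t₀ T ht₀ hT.le h2]
    · rw [← intervalIntegral.integral_add_adjacent_intervals (hii t₀ t₁) (hii t₁ T)]
      refine (abs_add_le _ _).trans ?_
      linarith [hfar t₁ le_rfl h2, hM σ ⟨hσ, h⟩ t₀ t₁ ht₀ h1 le_rfl]
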